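/- Let $t_0\in\mathbb R$, let $\mathcal D\subseteq\mathbb R^n$ be open and connected with $0\in\mathcal D$, and let $F$ be a set-valued map from $\mathbb R^n$ to the subsets of $\mathbb R^n$ that is locally bounded (every point has a neighbourhood $N$ such that $\bigcup_{y\in N}F(y)$ is bounded) and has compact (possibly empty) values. **Solutions.** Intervals are right-open and of nonzero length. A solution of $\dot x\in F(x)$ over an interval $\mathcal I$ is a locally absolutely continuous $x:\mathcal I\to\mathbb R^n$ with $\dot x(t)\in F(x(t))$ for almost all $t\in\mathcal I$. A solution starting at time $t_0$ is maximal if it has no proper right extension that is a solution, and complete if $\mathcal I=[t_0,\infty)$. Assume that $F$ admits local solutions over $\mathcal D$: for all $y\in\mathcal D$ and $\tau\ge t_0$ there are $T>\tau$ and a solution $x:[\tau,T)\to\mathbb R^n$ with $x(\tau)=y$. **Stability.** The inclusion $\dot x\in F(x)$ is *stable at $x=0$* if for every $\epsilon>0$ there is $\delta>0$ such that every maximal solution with $\|x(t_0)\|\le\delta$ is complete and satisfies $\|x(t)\|\le\epsilon$ for all $t\ge t_0$. It is *asymptotically stable at $x=0$* if it is stable at $x=0$ and there is $c>0$ such that every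 maximal solution with $\|x(t_0)\|\le c$ is complete and satisfies $\lim_{t\to\infty}\|x(t)\|=0$. It is *globally asymptotically stable at $x=0$* if it is stable at $x=0$ and every maximal solution is complete and satisfies $\lim_{t\to\infty}\|x(t)\|=0$. **Generalized derivatives.** For a locally Lipschitz $V:\mathcal D\to\mathbb R$ let $$\partial V(x)=\overline{\mathrm{co}}\bigl\{\lim_i\nabla V(x_i)\;:\;x_i\to x,\ V\text{ differentiable at every }x_i\bigr\}$$ be its Clarke gradient. $V$ is *regular* if, for all $x\in\mathcal D$ and $v\in\mathbb R^n$, the limit $\lim_{h\downarrow0}\frac{V(x+hv)-V(x)}{h}$ exists and equals $\limsup_{y\to x,\,h\downarrow0}\frac{V(y+hv)-V(y)}{h}$. Let $\mathcal U=\{U_i\}_{i=1}^\infty$ be a sequence of locally Lipschitz regular functions $U_i:\mathcal D\to\mathbb R$, and put $$\tilde F_{\mathcal U}(x)=\bigcap_{i=1}^\infty\bigl\{q\in F(x)\;:\;\exists a\in\mathbb R\ \ \forall p\in\partial U_i(x)\ \ p^Tq=a\bigr\}.$$ The *$\mathcal U$-generalized derivative* of $V$ at $x\in\mathcal D$ is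 $$\dot{\overline V}_{\mathcal U}(x)=\begin{cases}\min_{p\in\partial V(x)}\max_{q\in\tilde F_{\mathcal U}(x)}p^Tq & \text{if }V\text{ is regular},\\ \max_{p\in\partial V(x)}\max_{q\in\tilde F_{\mathcal U}(x)}p^Tq & \text{if }V\text{ is not regular},\end{cases}$$ and $-\infty$ whenever $\tilde F_{\mathcal U}(x)=\emptyset$. A function $V$ is *positive definite* on a set containing $0$ if $V(0)=0$ and $V(x)>0$ for all $x\neq0$ in that set. $V:\mathcal D\to\mathbb R$ is a *$\mathcal U$-generalized Lyapunov function* if it is locally Lipschitz and positive definite on $\mathcal D$ and $\dot{\overline V}_{\mathcal U}(x)\le0$ for all $x\in\mathcal D$. **Theorem.** Let $V:\mathcal D\to\mathbb R$ be a $\mathcal U$-generalized Lyapunov function for $\dot x\in F(x)$. Then: 1. $\dot x\in F(x)$ is stable at $x=0$. 2. If, in addition, there is a continuous positive definite function $W:\mathbb R^n\to\mathbb R$ with $\dot{\overline V}_{\mathcal U}(x)\le-W(x)$ for all $x\in\mathcal D$, then $\dot x\in F(x)$ is asymptotically stable at $x=0$. 3. If, in addition to the hypotheses of 2, $\mathcal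 D=\mathbb R^n$ and the sublevel sets $\{x\in\mathbb R^n: V(x)\le l\}$ are compact for all $l>0$, then $\dot x\in F(x)$ is globally asymptotically stable at $x=0$. -/

import Mathlib

open Filter Topology MeasureTheory Set

noncomputable section

namespace DiffIncl

variable {n : ℕ}

/-! ### Differential inclusions `ẋ ∈ F(x)` on `ℝⁿ` -/

/-- `I` is a right-open interval of nonzero length with starting point `t₀`:
either `[t₀, ∞)` or `[t₀, T)` with `t₀ < T < ∞`. -/
def IsTimeInterval (t₀ : ℝ) (I : Set ℝ) : Prop :=
  I = Ici t₀ ∨ ∃ T, t₀ < T ∧ I = Ico t₀ T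

/-- `x : I → ℝⁿ` is a solution of `ẋ ∈ F(x)` over the interval `I` starting at `t₀`:
it is locally absolutely continuous on `I` (absolutely continuous on every compact subinterval)
and, for almost every `t ∈ I`, it is differentiable at `t` with derivative in `F (x t)`.
Only the values of `x` on `I` matter. -/
structure IsSolution (F : EuclideanSpace ℝ (Fin n) → Set (EuclideanSpace ℝ (Fin n)))
    (t₀ : ℝ) (I : Set ℝ) (x : ℝ → EuclideanSpace ℝ (Fin n)) : Prop where
  interval : IsTimeInterval t₀ I
  absCont : ∀ a ∈ I, ∀ b ∈ I, AbsolutelyContinuousOnInterval x a b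
  deriv_mem : ∀ᵐ t ∂(volume.restrict I), ∃ v ∈ F (x t), HasDerivAt x v t

/-- A maximal solution: a solution without a proper right extension that is also a solution. -/
structure IsMaximalSolution (F : EuclideanSpace ℝ (Fin n) → Set (EuclideanSpace ℝ (Fin n)))
    (t₀ : ℝ) (I : Set ℝ) (x : ℝ → EuclideanSpace ℝ (Fin n)) : Prop where
  isSolution : IsSolution F t₀ I x
  maximal : ∀ (J : Set ℝ) (y : ℝ → EuclideanSpace ℝ (Fin n)),
    IsSolution F t₀ J y → I ⊆ J → EqOn y x I → J = I

/-- `F` admits local solutions over `D × [t₀, ∞)`: from every `y ∈ D` and every initial time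
`τ ≥ t₀` some solution exists over an interval `[τ, T)` with `T > τ`. -/
def AdmitsLocalSolutions (F : EuclideanSpace ℝ (Fin n) → Set (EuclideanSpace ℝ (Fin n)))
    (t₀ : ℝ) (D : Set (EuclideanSpace ℝ (Fin n))) : Prop :=
  ∀ y ∈ D, ∀ τ, t₀ ≤ τ → ∃ T, τ < T ∧
    ∃ x : ℝ → EuclideanSpace ℝ (Fin n), IsSolution F τ (Ico τ T) x ∧ x τ = y

/-- `F` is locally bounded: every point has a neighbourhood whose image under `F` is bounded. -/
def LocallyBounded (F : EuclideanSpace ℝ (Fin n) → Set (EuclideanSpace ℝ (Fin n))) : Prop :=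
  ∀ x, ∃ N ∈ 𝓝 x, Bornology.IsBounded (⋃ y ∈ N, F y)

/-! ### (Strong) stability at the origin -/

/-- Stability at `x = 0`; a maximal solution over `I` is complete when `I = [t₀, ∞)`. -/
def IsStable (F : EuclideanSpace ℝ (Fin n) → Set (EuclideanSpace ℝ (Fin n))) (t₀ : ℝ) : Prop :=
  ∀ ε > 0, ∃ δ > 0, ∀ (I : Set ℝ) (x : ℝ → EuclideanSpace ℝ (Fin n)),
    IsMaximalSolution F t₀ I x → x t₀ ∈ Metric.closedBall 0 δ →
      I = Ici t₀ ∧ ∀ t, t₀ ≤ t → x t ∈ Metric.closedBall 0 ε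

/-- Asymptotic stability at `x = 0`. -/
def IsAsymptoticallyStable (F : EuclideanSpace ℝ (Fin n) → Set (EuclideanSpace ℝ (Fin n)))
    (t₀ : ℝ) : Prop :=
  IsStable F t₀ ∧ ∃ c > 0, ∀ (I : Set ℝ) (x : ℝ → EuclideanSpace ℝ (Fin n)),
    IsMaximalSolution F t₀ I x → x t₀ ∈ Metric.closedBall 0 c →
      I = Ici t₀ ∧ Tendsto (fun t => ‖x t‖) atTop (𝓝 0)

/-- Global asymptotic stability at `x = 0`. -/
def IsGloballyAsymptoticallyStable
    (F : EuclideanSpace ℝ (Fin n) → Set (EuclideanSpace ℝ (Fin n))) (t₀ : ℝ) : Prop :=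
  IsStable F t₀ ∧ ∀ (I : Set ℝ) (x : ℝ → EuclideanSpace ℝ (Fin n)),
    IsMaximalSolution F t₀ I x → I = Ici t₀ ∧ Tendsto (fun t => ‖x t‖) atTop (𝓝 0)

/-! ### Clarke calculus

Functions on the open set `D` are represented by total functions; at a point of `D` the notions
below depend only on the germ of the function, hence only on its values on `D`. -/

/-- The Clarke gradient: the closed convex hull of all limits of gradients `∇V(xᵢ)` along
sequences `xᵢ → x` of points at which `V` is differentiable. -/
def clarkeGradient (V : EuclideanSpace ℝ (Fin n) → ℝ) (x : EuclideanSpace ℝ (Fin n)) :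
    Set (EuclideanSpace ℝ (Fin n)) :=
  closure (convexHull ℝ {p | ∃ u : ℕ → EuclideanSpace ℝ (Fin n),
    Tendsto u atTop (𝓝 x) ∧ (∀ i, DifferentiableAt ℝ V (u i)) ∧
      Tendsto (fun i => gradient V (u i)) atTop (𝓝 p)})

/-- The Clarke generalized directional derivative
`V°(x; v) = limsup_{y → x, h ↓ 0} (V(y + h v) - V(y)) / h`
(a bounded real limsup when `V` is Lipschitz near `x`, the only case in which it is used). -/
def clarkeDirDeriv (V : EuclideanSpace ℝ (Fin n) → ℝ) (x v : EuclideanSpace ℝ (Fin n)) : ℝ :=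
  limsup (fun z : EuclideanSpace ℝ (Fin n) × ℝ => (V (z.1 + z.2 • v) - V z.1) / z.2)
    (𝓝 x ×ˢ 𝓝[>] (0 : ℝ))

/-- `V` is (Clarke) regular on `D`: at every `x ∈ D` and in every direction `v` the one-sided
directional derivative `V'(x; v)` exists and equals `V°(x; v)`. -/
def IsRegularOn (V : EuclideanSpace ℝ (Fin n) → ℝ) (D : Set (EuclideanSpace ℝ (Fin n))) : Prop :=
  ∀ x ∈ D, ∀ v, Tendsto (fun h : ℝ => (V (x + h • v) - V x) / h) (𝓝[>] (0 : ℝ))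
    (𝓝 (clarkeDirDeriv V x v))

/-! ### Reduced inclusions and generalized derivatives -/

/-- The reduction `G_U^F(x)`: the `q ∈ F(x)` for which `p ↦ pᵀ q` is constant on `∂U(x)`. -/
def reduction (F : EuclideanSpace ℝ (Fin n) → Set (EuclideanSpace ℝ (Fin n)))
    (U : EuclideanSpace ℝ (Fin n) → ℝ) (x : EuclideanSpace ℝ (Fin n)) :
    Set (EuclideanSpace ℝ (Fin n)) :=
  {q | q ∈ F x ∧ ∃ a : ℝ, ∀ p ∈ clarkeGradient U x, inner ℝ p q = a}

/-- The `𝒰`-reduced inclusion for the family `𝒰 = (U i)`. -/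
def reducedInclusion (F : EuclideanSpace ℝ (Fin n) → Set (EuclideanSpace ℝ (Fin n)))
    (U : ℕ → EuclideanSpace ℝ (Fin n) → ℝ) (x : EuclideanSpace ℝ (Fin n)) :
    Set (EuclideanSpace ℝ (Fin n)) :=
  ⋂ i, reduction F (U i) x

open Classical in
/-- The `𝒰`-generalized derivative at `x ∈ D` of a locally Lipschitz `V : D → ℝ`, with values in
the extended reals: `-∞` when the reduced inclusion is empty; otherwise
`min_{p ∈ ∂V(x)} max_q pᵀ q` if `V` is regular on `D` and `max_{p ∈ ∂V(x)} max_q pᵀ q` if not,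
with `q` ranging over the reduced inclusion at `x`. (The extrema are attained when `F x` is
compact and `V` is Lipschitz near `x`, so `⨅` and `⨆` are `min` and `max`.) -/
def genDeriv (F : EuclideanSpace ℝ (Fin n) → Set (EuclideanSpace ℝ (Fin n)))
    (D : Set (EuclideanSpace ℝ (Fin n))) (U : ℕ → EuclideanSpace ℝ (Fin n) → ℝ)
    (V : EuclideanSpace ℝ (Fin n) → ℝ) (x : EuclideanSpace ℝ (Fin n)) : EReal :=
  if reducedInclusion F U x = ∅ then ⊥
  else if IsRegularOn V D then
    ⨅ p ∈ clarkeGradient V x, ⨆ q ∈ reducedInclusion F U x, ((inner ℝ p q : ℝ) : EReal)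
  else
    ⨆ p ∈ clarkeGradient V x, ⨆ q ∈ reducedInclusion F U x, ((inner ℝ p q : ℝ) : EReal)

/-- `V` is positive definite on `D` (a set containing `0`). -/
def IsPosDefOn (V : EuclideanSpace ℝ (Fin n) → ℝ) (D : Set (EuclideanSpace ℝ (Fin n))) : Prop :=
  V 0 = 0 ∧ ∀ x ∈ D, x ≠ 0 → 0 < V x

/-- `V : D → ℝ` is a `𝒰`-generalized Lyapunov function for `ẋ ∈ F(x)`. -/
structure IsGenLyapunov (F : EuclideanSpace ℝ (Fin n) → Set (EuclideanSpace ℝ (Fin n)))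
    (D : Set (EuclideanSpace ℝ (Fin n))) (U : ℕ → EuclideanSpace ℝ (Fin n) → ℝ)
    (V : EuclideanSpace ℝ (Fin n) → ℝ) : Prop where
  locallyLipschitz : LocallyLipschitzOn D V
  posDef : IsPosDefOn V D
  genDeriv_nonpos : ∀ x ∈ D, genDeriv F D U V x ≤ 0

end DiffIncl

end

/-! The core is a chain rule for nonsmooth functions along solutions. Along a solution `x` in `D`,
`V ∘ x` and all `U i ∘ x` are absolutely continuous, and since the family is countable they are, at
almost every `t`, all differentiable while `v = x'(t) ∈ F (x t)`. A locally Lipschitz function does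
not distinguish a curve from its tangent, so these derivatives are two-sided directional derivatives
along `v`. For a regular function such a derivative `d` forces `p·v = d` for every Clarke gradient
`p`: the bound `p·w ≤ V°(y; w)` is used with `w = v` and `w = -v`. Hence `v` survives every
reduction and competes in the maxima defining the generalized derivative. If `V` is regular, every
`p` gives `p·v = d`, so the min-max bounds `d`; otherwise some `p ∈ ∂V` has `d ≤ p·v`, so the
max-max does (`le_genDeriv`). Integration gives `IsSolution.sub_le`.

The rest is Lyapunov's argument. A solution starting where `V` is below its minimum on a sphere
cannot reach that sphere; confinement to a compact set bounds the speed, so a maximal solution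
cannot stop in finite time; and decay at rate `W` would make `V` negative if the solution stayed
away from the origin. -/

/-! ### Absolutely continuous curves -/

namespace AbsolutelyContinuousOnInterval

/-- An absolutely continuous function whose derivative is a.e. at most `c` grows at rate at
most `c`. -/
theorem sub_le_of_ae_deriv_le {f : ℝ → ℝ} {a b c : ℝ} (hab : a ≤ b)
    (hf : AbsolutelyContinuousOnInterval f a b)
    (hd : ∀ᵐ t, t ∈ Ioo a b → deriv f t ≤ c) : f b - f a ≤ c * (b - a) := by
  rw [← hf.integral_deriv_eq_sub]
  have h : ∫ t in a..b, deriv f t ≤ ∫ _ in a..b, c := by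
    refine intervalIntegral.integral_mono_ae_restrict hab hf.intervalIntegrable_deriv
      intervalIntegrable_const ?_
    rw [← restrict_Ioo_eq_restrict_Icc]
    exact (ae_restrict_iff' measurableSet_Ioo).2 hd
  simpa [mul_comm] using h

theorem lipschitzOn_comp {X Y : Type*} [PseudoMetricSpace X] [PseudoMetricSpace Y]
    {f : ℝ → X} {g : X → Y} {a b : ℝ} {K : NNReal} (hg : LipschitzOnWith K g (f '' uIcc a b))
    (hf : AbsolutelyContinuousOnInterval f a b) :
    AbsolutelyContinuousOnInterval (fun t => g (f t)) a b := by
  unfold AbsolutelyContinuousOnInterval at hf ⊢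
  refine squeeze_zero' (.of_forall fun _ => Finset.sum_nonneg fun _ _ => dist_nonneg) ?_
    (by simpa using hf.const_mul (K : ℝ))
  rw [eventually_inf_principal]
  filter_upwards with E hE
  rw [Finset.mul_sum]
  gcongr with i hi
  exact hg.dist_le_mul _ (mem_image_of_mem f (hE.1 i hi).1) _ (mem_image_of_mem f (hE.1 i hi).2)

/-- Precomposition with a nonexpansive map that does not enlarge intervals. -/
theorem comp_of_uIoc_subset {X : Type*} [PseudoMetricSpace X] {f : ℝ → X} {φ : ℝ → ℝ}
    {a b c d : ℝ} (hf : AbsolutelyContinuousOnInterval f c d) (hφ : LipschitzWith 1 φ)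
    (hmaps : MapsTo φ (uIcc a b) (uIcc c d)) (hsub : ∀ s t, uIoc (φ s) (φ t) ⊆ uIoc s t) :
    AbsolutelyContinuousOnInterval (fun t => f (φ t)) a b := by
  rw [absolutelyContinuousOnInterval_iff] at hf ⊢
  intro ε hε
  obtain ⟨δ, hδ, h⟩ := hf ε hε
  refine ⟨δ, hδ, fun E hE hlt => h (E.1, fun i => (φ (E.2 i).1, φ (E.2 i).2)) ⟨?_, ?_⟩ ?_⟩
  · exact fun i hi => ⟨hmaps (hE.1 i hi).1, hmaps (hE.1 i hi).2⟩
  · exact fun i hi j hj hij => (hE.2 hi hj hij).mono (hsub _ _) (hsub _ _)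
  · refine lt_of_le_of_lt (Finset.sum_le_sum fun i _ => ?_) hlt
    simpa using hφ.dist_le_mul (E.2 i).1 (E.2 i).2

/-- Gluing two absolutely continuous functions that agree at the common endpoint. -/
theorem glue {E : Type*} [SeminormedAddCommGroup E] {f g : ℝ → E} {a b c : ℝ} (hab : a ≤ b)
    (hbc : b ≤ c) (hf : AbsolutelyContinuousOnInterval f a b)
    (hg : AbsolutelyContinuousOnInterval g b c) (h : f b = g b) :
    AbsolutelyContinuousOnInterval (fun t => if t < b then f t else g t) a c := by
  -- The glued function is `f (min t b) + g (max t b) - g b`; clamping is nonexpansive and keeps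
  -- disjoint intervals disjoint.
  have h1 : AbsolutelyContinuousOnInterval (fun t => f (min t b)) a c := by
    refine hf.comp_of_uIoc_subset (LipschitzWith.id.min_const b) ?_ ?_
    · intro t ht
      rw [uIcc_of_le (hab.trans hbc)] at ht
      rw [uIcc_of_le hab]
      exact ⟨le_min ht.1 hab, min_le_right _ _⟩
    · intro s t u hu
      simp only [mem_uIoc] at hu ⊢
      grind
  have h2 : AbsolutelyContinuousOnInterval (fun t => g (max t b)) a c := by
    refine hg.comp_of_uIoc_subset (LipschitzWith.id.max_const b) ?_ ?_
    · intro t ht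
      rw [uIcc_of_le (hab.trans hbc)] at ht
      rw [uIcc_of_le hbc]
      exact ⟨le_max_right _ _, max_le ht.2 hbc⟩
    · intro s t u hu
      simp only [mem_uIoc] at hu ⊢
      grind
  have hc : AbsolutelyContinuousOnInterval (fun _ : ℝ => g b) a c :=
    (LipschitzWith.const (g b)).lipschitzOnWith.absolutelyContinuousOnInterval
  convert (h1.fun_add h2).fun_sub hc using 2 with t
  split_ifs with ht
  · rw [min_eq_left ht.le, max_eq_right ht.le, add_sub_cancel_right]
  · rw [min_eq_right (not_lt.1 ht), max_eq_left (not_lt.1 ht), h, add_sub_cancel_left]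

/-- An absolutely continuous curve whose speed is a.e. at most `M` moves by at most `M (b - a)`. -/
theorem norm_sub_le_of_ae_hasDerivAt {E : Type*} [NormedAddCommGroup E] [InnerProductSpace ℝ E]
    {x : ℝ → E} {a b M : ℝ} (hab : a ≤ b) (hM : 0 ≤ M)
    (hx : AbsolutelyContinuousOnInterval x a b)
    (hd : ∀ᵐ t, t ∈ Ioo a b → ∃ v, ‖v‖ ≤ M ∧ HasDerivAt x v t) : ‖x b - x a‖ ≤ M * (b - a) := by
  -- Pairing the curve with its own displacement reduces to the scalar bound `‖w‖² ≤ ‖w‖ M (b - a)`.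
  set w := x b - x a with hw
  have hac : AbsolutelyContinuousOnInterval (fun t => inner ℝ w (x t)) a b :=
    hx.lipschitzOn_comp (g := fun z => inner ℝ w z)
      ((innerSL ℝ w).lipschitz.lipschitzOnWith)
  have h := hac.sub_le_of_ae_deriv_le (c := ‖w‖ * M) hab (by
    filter_upwards [hd] with t ht hmem
    obtain ⟨v, hv, hxv⟩ := ht hmem
    have : HasDerivAt (fun t => inner ℝ w (x t)) (inner ℝ w v) t :=
      (innerSL ℝ w).hasFDerivAt.comp_hasDerivAt t hxv
    rw [this.deriv]
    exact (real_inner_le_norm w v).trans (by gcongr))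
  rw [← inner_sub_right, ← hw, real_inner_self_eq_norm_sq] at h
  rcases (norm_nonneg w).eq_or_lt with h0 | h0
  · rw [← h0]
    exact mul_nonneg hM (sub_nonneg.2 hab)
  · nlinarith

end AbsolutelyContinuousOnInterval

namespace DiffIncl

variable {n : ℕ}

/-! ### Clarke gradients and directional derivatives -/

theorem exists_lipschitzOnWith_ball {D : Set (EuclideanSpace ℝ (Fin n))}
    {V : EuclideanSpace ℝ (Fin n) → ℝ} (hD : IsOpen D) (hV : LocallyLipschitzOn D V)
    {x : EuclideanSpace ℝ (Fin n)} (hx : x ∈ D) :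
    ∃ (K : NNReal) (r : ℝ), 0 < r ∧ LipschitzOnWith K V (Metric.ball x r) := by
  obtain ⟨K, t, ht, hK⟩ := hV hx
  rw [hD.nhdsWithin_eq hx] at ht
  obtain ⟨r, hr, hrt⟩ := Metric.mem_nhds_iff.1 ht
  exact ⟨K, r, hr, hK.mono hrt⟩

theorem fderiv_eq_inner_gradient (V : EuclideanSpace ℝ (Fin n) → ℝ)
    (x v : EuclideanSpace ℝ (Fin n)) : fderiv ℝ V x v = inner ℝ (gradient V x) v := by
  rw [← toDual_gradient, InnerProductSpace.toDual_apply_apply]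

theorem norm_gradient_le {V : EuclideanSpace ℝ (Fin n) → ℝ} {x y : EuclideanSpace ℝ (Fin n)}
    {K : NNReal} {r : ℝ} (hK : LipschitzOnWith K V (Metric.ball x r)) (hy : y ∈ Metric.ball x r) :
    ‖gradient V y‖ ≤ K := by
  rw [gradient, LinearIsometryEquiv.norm_map]
  exact norm_fderiv_le_of_lipschitzOn ℝ (Metric.isOpen_ball.mem_nhds hy) hK

/-- The difference quotient of `V` along the ray from `y` in direction `v`. -/
theorem tendsto_slope_ray {V : EuclideanSpace ℝ (Fin n) → ℝ} {y : EuclideanSpace ℝ (Fin n)}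
    (hy : DifferentiableAt ℝ V y) (v : EuclideanSpace ℝ (Fin n)) :
    Tendsto (fun h : ℝ => (V (y + h • v) - V y) / h) (𝓝[>] 0) (𝓝 (inner ℝ (gradient V y) v)) := by
  have h := (hy.hasFDerivAt.hasLineDerivAt v).tendsto_slope_zero_right
  rw [fderiv_eq_inner_gradient] at h
  simpa [div_eq_inv_mul] using h

/-- Makes the real `limsup` in `clarkeDirDeriv` meaningful: without an upper bound it would take a
default value. -/
theorem isBoundedUnder_quotient {V : EuclideanSpace ℝ (Fin n) → ℝ}
    {x : EuclideanSpace ℝ (Fin n)} {K : NNReal} {r : ℝ} (hr : 0 < r)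
    (hK : LipschitzOnWith K V (Metric.ball x r)) (v : EuclideanSpace ℝ (Fin n)) :
    IsBoundedUnder (· ≤ ·) (𝓝 x ×ˢ 𝓝[>] (0 : ℝ))
      (fun z : EuclideanSpace ℝ (Fin n) × ℝ => (V (z.1 + z.2 • v) - V z.1) / z.2) := by
  refine ⟨K * ‖v‖, ?_⟩
  rw [eventually_map]
  have hpos : ∀ᶠ z : EuclideanSpace ℝ (Fin n) × ℝ in 𝓝 x ×ˢ 𝓝[>] (0 : ℝ), 0 < z.2 :=
    tendsto_snd.eventually self_mem_nhdsWithin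
  have hball : ∀ᶠ z : EuclideanSpace ℝ (Fin n) × ℝ in 𝓝 x ×ˢ 𝓝[>] (0 : ℝ),
      z.1 ∈ Metric.ball x r := tendsto_fst.eventually (Metric.ball_mem_nhds x hr)
  have hball' : ∀ᶠ z : EuclideanSpace ℝ (Fin n) × ℝ in 𝓝 x ×ˢ 𝓝[>] (0 : ℝ),
      z.1 + z.2 • v ∈ Metric.ball x r := by
    have : Tendsto (fun z : EuclideanSpace ℝ (Fin n) × ℝ => z.1 + z.2 • v)
        (𝓝 x ×ˢ 𝓝[>] (0 : ℝ)) (𝓝 (x + (0 : ℝ) • v)) :=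
      tendsto_fst.add ((tendsto_snd.mono_right nhdsWithin_le_nhds).smul_const v)
    rw [zero_smul, add_zero] at this
    exact this.eventually (Metric.ball_mem_nhds x hr)
  filter_upwards [hpos, hball, hball'] with z hz h1 h2
  rw [div_le_iff₀ hz]
  have := hK.dist_le_mul _ h2 _ h1
  rw [Real.dist_eq, dist_eq_norm, add_sub_cancel_left, norm_smul, Real.norm_of_nonneg hz.le] at this
  calc _ ≤ _ := le_abs_self _
    _ ≤ _ := this
    _ = _ := by ring

/-- Elements of the Clarke gradient are dominated by the Clarke directional derivative. -/
theorem inner_le_clarkeDirDeriv {V : EuclideanSpace ℝ (Fin n) → ℝ}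
    {x : EuclideanSpace ℝ (Fin n)} {K : NNReal} {r : ℝ} (hr : 0 < r)
    (hK : LipschitzOnWith K V (Metric.ball x r)) {p : EuclideanSpace ℝ (Fin n)}
    (hp : p ∈ clarkeGradient V x) (v : EuclideanSpace ℝ (Fin n)) :
    inner ℝ p v ≤ clarkeDirDeriv V x v := by
  suffices h : clarkeGradient V x ⊆ {p | inner ℝ p v ≤ clarkeDirDeriv V x v} from h hp
  refine closure_minimal (convexHull_min ?_ ?_)
    (isClosed_le (continuous_id.inner continuous_const) continuous_const)
  · rintro p ⟨u, hu, hdiff, hgrad⟩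
    change inner ℝ p v ≤ clarkeDirDeriv V x v
    refine le_of_forall_gt_imp_ge_of_dense fun c hc => ?_
    -- Currying freezes the base point at `u i` and lets only `h ↓ 0`; the quotient then tends to
    -- the slope of `∇V (u i)`.
    have hev := (eventually_lt_of_limsup_lt hc (isBoundedUnder_quotient hr hK v)).curry
    refine le_of_tendsto (hgrad.inner tendsto_const_nhds) ?_
    filter_upwards [hu.eventually hev] with i hi
    exact le_of_tendsto (tendsto_slope_ray (hdiff i) v) (hi.mono fun _ h => h.le)
  · exact convex_halfSpace_le ⟨fun a b => inner_add_left a b v,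
      fun c a => by simp [inner_smul_left]⟩ _

/-- If all gradients near `x` have slope at most `c` in direction `v`, then `V` grows at rate
at most `c` along the ray from `x` in direction `v`. -/
theorem sub_le_of_gradient_le {V : EuclideanSpace ℝ (Fin n) → ℝ}
    {x v : EuclideanSpace ℝ (Fin n)} {K : NNReal} {r c h : ℝ}
    (hK : LipschitzOnWith K V (Metric.ball x r))
    (hc : ∀ z ∈ Metric.ball x r, DifferentiableAt ℝ V z → inner ℝ (gradient V z) v ≤ c)
    (h0 : 0 ≤ h) (hv : h * ‖v‖ < r) : V (x + h • v) - V x ≤ c * h := by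
  -- A globally Lipschitz extension, so that Rademacher's theorem applies on the whole space.
  obtain ⟨g, hg, hgV⟩ := hK.extend_real
  have hball : ∀ {s}, s ∈ Icc 0 h → ∀ {y}, y ∈ Metric.ball x (r - h * ‖v‖) →
      y + s • v ∈ Metric.ball x r := by
    intro s hs y hy
    rw [mem_ball_iff_norm] at hy ⊢
    calc ‖y + s • v - x‖ = ‖(y - x) + s • v‖ := by congr 1; abel
      _ ≤ ‖y - x‖ + ‖s • v‖ := norm_add_le _ _
      _ = ‖y - x‖ + s * ‖v‖ := by rw [norm_smul, Real.norm_of_nonneg hs.1]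
      _ ≤ ‖y - x‖ + h * ‖v‖ := by gcongr; exact hs.2
      _ < r := by linarith
  have hx : x ∈ Metric.ball x (r - h * ‖v‖) := Metric.mem_ball_self (by linarith)
  have hA : MeasurableSet {z | DifferentiableAt ℝ g z} := measurableSet_of_differentiableAt ℝ g
  -- The ray from `x` may lie inside the null set of non-differentiability. By Fubini, almost every
  -- parallel line meets that set in a null set; the estimate holds for those base points, which are
  -- dense, and passes to `x` by continuity.
  have hae : ∀ᵐ y : EuclideanSpace ℝ (Fin n), ∀ᵐ s : ℝ, DifferentiableAt ℝ g (y + s • v) := by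
    rw [Measure.ae_ae_comm (p := fun (y : EuclideanSpace ℝ (Fin n)) (s : ℝ) =>
      DifferentiableAt ℝ g (y + s • v))
      (hA.preimage (f := fun z : EuclideanSpace ℝ (Fin n) × ℝ => z.1 + z.2 • v) (by fun_prop))]
    exact .of_forall fun s => (measurePreserving_add_right volume (s • v)).quasiMeasurePreserving.ae
      hg.ae_differentiableAt
  have hdense := Measure.dense_of_ae hae
  have hclosed : IsClosed {y | g (y + h • v) - g y ≤ c * h} := by
    have := hg.continuous
    exact isClosed_le (by fun_prop) (by fun_prop)
  have key : Metric.ball x (r - h * ‖v‖) ∩ {y | ∀ᵐ s : ℝ, DifferentiableAt ℝ g (y + s • v)} ⊆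
      {y | g (y + h • v) - g y ≤ c * h} := by
    rintro y ⟨hy, hys⟩
    have hlip : LipschitzWith (K * ‖v‖₊) (fun s : ℝ => g (y + s • v)) := by
      refine hg.comp (LipschitzWith.of_dist_le_mul fun s t => ?_)
      rw [dist_add_left, dist_eq_norm, ← sub_smul, norm_smul, mul_comm, dist_eq_norm]; simp
    have := hlip.lipschitzOnWith.absolutelyContinuousOnInterval.sub_le_of_ae_deriv_le
      (c := c) h0 (by
        filter_upwards [hys] with s hs hmem
        have hmem' := hball (Ioo_subset_Icc_self hmem) hy
        have heq : g =ᶠ[𝓝 (y + s • v)] V := by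
          filter_upwards [Metric.isOpen_ball.mem_nhds hmem'] with z hz using (hgV hz).symm
        have hVd : DifferentiableAt ℝ V (y + s • v) := heq.differentiableAt_iff.1 hs
        have hline : HasDerivAt (fun s : ℝ => y + s • v) v s := by
          simpa using ((hasDerivAt_id s).smul_const v).const_add y
        have hd : HasDerivAt (fun s : ℝ => g (y + s • v)) (fderiv ℝ g (y + s • v) v) s :=
          hs.hasFDerivAt.comp_hasDerivAt s hline
        rw [hd.deriv, heq.fderiv_eq, fderiv_eq_inner_gradient]
        exact hc _ hmem' hVd)
    simpa using this
  have hmem : x ∈ {y | g (y + h • v) - g y ≤ c * h} :=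
    closure_minimal key hclosed (hdense.open_subset_closure_inter Metric.isOpen_ball hx)
  rw [hgV (hball (right_mem_Icc.2 h0) hx), hgV (Metric.mem_ball_self (by
    linarith [mul_nonneg h0 (norm_nonneg v)]))]
  exact hmem

/-- A one-sided directional derivative of a Lipschitz function is attained from below on the
Clarke gradient. -/
theorem exists_mem_clarkeGradient_le_inner {V : EuclideanSpace ℝ (Fin n) → ℝ}
    {x v : EuclideanSpace ℝ (Fin n)} {K : NNReal} {r d : ℝ} (hr : 0 < r)
    (hK : LipschitzOnWith K V (Metric.ball x r))
    (hd : Tendsto (fun h : ℝ => (V (x + h • v) - V x) / h) (𝓝[>] 0) (𝓝 d)) :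
    ∃ p ∈ clarkeGradient V x, d ≤ inner ℝ p v := by
  -- Otherwise all gradients near `x` would have slope at most `d - ε` along `v`, and so would the
  -- difference quotients, whose limit is `d`. The gradients found are bounded by `K`, so a
  -- subsequence converges to the required `p`.
  have key : ∀ ε > 0, ∃ z ∈ Metric.ball x (min r ε), DifferentiableAt ℝ V z ∧
      d - ε < inner ℝ (gradient V z) v := by
    intro ε hε
    by_contra! hcon
    have hρ : 0 < min r ε := lt_min hr hε
    have hev : ∀ᶠ h : ℝ in 𝓝[>] 0, (V (x + h • v) - V x) / h ≤ d - ε := by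
      have hsm : ∀ᶠ h : ℝ in 𝓝[>] 0, h * ‖v‖ < min r ε := by
        have : Tendsto (fun h : ℝ => h * ‖v‖) (𝓝[>] 0) (𝓝 (0 * ‖v‖)) :=
          (tendsto_id.mono_left nhdsWithin_le_nhds).mul_const _
        rw [zero_mul] at this
        exact this.eventually (gt_mem_nhds hρ)
      filter_upwards [hsm, self_mem_nhdsWithin] with h hh (hpos : 0 < h)
      rw [div_le_iff₀ hpos]
      exact sub_le_of_gradient_le (hK.mono (Metric.ball_subset_ball (min_le_left _ _))) hcon
        hpos.le hh
    linarith [le_of_tendsto hd hev]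
  choose! z hz hzd hzg using key
  have hpos : ∀ k : ℕ, (0 : ℝ) < 1 / (k + 1) := fun k => Nat.one_div_pos_of_nat
  set u : ℕ → EuclideanSpace ℝ (Fin n) := fun k => z (1 / (k + 1)) with hu
  have hux : Tendsto u atTop (𝓝 x) := by
    rw [tendsto_iff_dist_tendsto_zero]
    refine squeeze_zero (fun _ => dist_nonneg) (fun k => ?_) tendsto_one_div_add_atTop_nhds_zero_nat
    exact (Metric.mem_ball.1 (hz _ (hpos k))).le.trans (min_le_right _ _)
  obtain ⟨p, -, φ, hφ, hlim⟩ := (isCompact_closedBall (0 : EuclideanSpace ℝ (Fin n)) K).tendsto_subseq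
    (x := fun k => gradient V (u k)) fun k => by
      rw [mem_closedBall_zero_iff]
      exact norm_gradient_le hK (Metric.ball_subset_ball (min_le_left _ _) (hz _ (hpos k)))
  refine ⟨p, subset_closure (subset_convexHull ℝ _ ⟨u ∘ φ, hux.comp hφ.tendsto_atTop,
    fun k => hzd _ (hpos _), hlim⟩), ?_⟩
  have h1 : Tendsto (fun k => d - 1 / ((φ k : ℝ) + 1)) atTop (𝓝 (d - 0)) :=
    tendsto_const_nhds.sub (tendsto_one_div_add_atTop_nhds_zero_nat.comp hφ.tendsto_atTop)
  rw [sub_zero] at h1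
  exact le_of_tendsto_of_tendsto' h1 (hlim.inner tendsto_const_nhds)
    fun k => (hzg _ (hpos (φ k))).le

/-- For a Lipschitz function, the derivative along a curve is the derivative along its tangent. -/
theorem hasLineDerivAt_of_hasDerivAt_comp {V : EuclideanSpace ℝ (Fin n) → ℝ}
    {x : ℝ → EuclideanSpace ℝ (Fin n)} {t d : ℝ} {v : EuclideanSpace ℝ (Fin n)} {K : NNReal}
    {r : ℝ} (hr : 0 < r) (hK : LipschitzOnWith K V (Metric.ball (x t) r)) (hx : HasDerivAt x v t)
    (hd : HasDerivAt (fun s => V (x s)) d t) : HasLineDerivAt ℝ V d (x t) v := by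
  unfold HasLineDerivAt
  rw [hasDerivAt_iff_isLittleO_nhds_zero] at hx hd ⊢
  have hcont : Tendsto (fun h : ℝ => x (t + h)) (𝓝 0) (𝓝 (x t)) := by
    have h1 := hx.trans_isBigO (Asymptotics.isBigO_refl (fun h : ℝ => h) (𝓝 0))
    have h2 : Tendsto (fun h : ℝ => x (t + h) - x t - h • v) (𝓝 0) (𝓝 0) :=
      h1.isBigO.trans_tendsto tendsto_id
    have h3 : Tendsto (fun h : ℝ => h • v + x t) (𝓝 0) (𝓝 ((0 : ℝ) • v + x t)) :=
      (tendsto_id.smul_const v).add_const _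
    have h4 := h2.add h3
    rw [zero_smul, zero_add, zero_add] at h4
    refine h4.congr fun h => ?_
    abel
  have hray : Tendsto (fun h : ℝ => x t + h • v) (𝓝 0) (𝓝 (x t)) := by
    have h3 : Tendsto (fun h : ℝ => x t + h • v) (𝓝 0) (𝓝 (x t + (0 : ℝ) • v)) :=
      (tendsto_id.smul_const v).const_add _
    rwa [zero_smul, add_zero] at h3
  -- The curve and its tangent line differ by `o(h)`, hence so do the values of the Lipschitz `V` on
  -- them.
  have hdiff : (fun h : ℝ => V (x t + h • v) - V (x (t + h))) =o[𝓝 0] fun h => h := by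
    refine Asymptotics.IsBigO.trans_isLittleO (.of_bound K ?_) hx
    filter_upwards [hcont.eventually (Metric.ball_mem_nhds _ hr),
      hray.eventually (Metric.ball_mem_nhds _ hr)] with h h1 h2
    have := hK.dist_le_mul _ h2 _ h1
    rwa [dist_eq_norm, dist_comm, dist_eq_norm, ← sub_sub] at this
  refine (hdiff.add hd).congr_left fun h => ?_
  simp only [zero_add, zero_smul, add_zero]
  abel

/-- For a regular function, all Clarke gradients agree on a direction in which the two-sided
directional derivative exists. -/
theorem inner_eq_of_isRegularOn {D : Set (EuclideanSpace ℝ (Fin n))}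
    {V : EuclideanSpace ℝ (Fin n) → ℝ} (hD : IsOpen D) (hV : LocallyLipschitzOn D V)
    (hreg : IsRegularOn V D) {y v : EuclideanSpace ℝ (Fin n)} (hy : y ∈ D) {d : ℝ}
    (hd : HasLineDerivAt ℝ V d y v) {p : EuclideanSpace ℝ (Fin n)} (hp : p ∈ clarkeGradient V y) :
    inner ℝ p v = d := by
  obtain ⟨K, r, hr, hK⟩ := exists_lipschitzOnWith_ball hD hV hy
  have key : ∀ {w e}, HasLineDerivAt ℝ V e y w → inner ℝ p w ≤ e := by
    intro w e he
    have h1 := he.tendsto_slope_zero_right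
    simp only [smul_eq_mul, ← div_eq_inv_mul] at h1
    rw [tendsto_nhds_unique h1 (hreg y hy w)]
    exact inner_le_clarkeDirDeriv hr hK hp w
  refine le_antisymm (key hd) ?_
  -- In direction `-v` the two-sided derivative is `-d`, which yields the reverse inequality.
  have := key (hd.smul (-1))
  rw [neg_smul, one_smul, inner_neg_right, neg_smul, one_smul] at this
  linarith

/-! ### Generalized derivatives along solutions -/

variable {F : EuclideanSpace ℝ (Fin n) → Set (EuclideanSpace ℝ (Fin n))}
  {D : Set (EuclideanSpace ℝ (Fin n))} {U : ℕ → EuclideanSpace ℝ (Fin n) → ℝ}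
  {V : EuclideanSpace ℝ (Fin n) → ℝ} {t₀ : ℝ} {I : Set ℝ} {x : ℝ → EuclideanSpace ℝ (Fin n)}

/-- The generalized derivative dominates the directional derivative in every direction of `F y`
in which all the functions of the family have two-sided directional derivatives. -/
theorem le_genDeriv (hD : IsOpen D) (hU : ∀ i, LocallyLipschitzOn D (U i) ∧ IsRegularOn (U i) D)
    (hV : LocallyLipschitzOn D V) {y v : EuclideanSpace ℝ (Fin n)} (hy : y ∈ D) (hv : v ∈ F y)
    {d : ℝ} (hVd : HasLineDerivAt ℝ V d y v) (hUd : ∀ i, ∃ e, HasLineDerivAt ℝ (U i) e y v) :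
    (d : EReal) ≤ genDeriv F D U V y := by
  have hmem : v ∈ reducedInclusion F U y := by
    refine mem_iInter.2 fun i => ⟨hv, ?_⟩
    obtain ⟨e, he⟩ := hUd i
    exact ⟨e, fun p hp => inner_eq_of_isRegularOn hD (hU i).1 (hU i).2 hy he hp⟩
  have hle : ∀ p, ((inner ℝ p v : ℝ) : EReal) ≤
      ⨆ q ∈ reducedInclusion F U y, ((inner ℝ p q : ℝ) : EReal) := fun p =>
    le_iSup₂ (f := fun q (_ : q ∈ reducedInclusion F U y) => ((inner ℝ p q : ℝ) : EReal)) v hmem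
  unfold genDeriv
  rw [if_neg (Set.Nonempty.ne_empty ⟨v, hmem⟩)]
  split_ifs with hreg
  · refine le_iInf₂ fun p hp => ?_
    rw [← inner_eq_of_isRegularOn hD hV hreg hy hVd hp]
    exact hle p
  · obtain ⟨K, r, hr, hK⟩ := exists_lipschitzOnWith_ball hD hV hy
    have hslope := hVd.tendsto_slope_zero_right
    simp only [smul_eq_mul, ← div_eq_inv_mul] at hslope
    obtain ⟨p, hp, hdp⟩ := exists_mem_clarkeGradient_le_inner hr hK hslope
    exact ((EReal.coe_le_coe_iff.2 hdp).trans (hle p)).trans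
      (le_iSup₂ (f := fun p (_ : p ∈ clarkeGradient V y) =>
        ⨆ q ∈ reducedInclusion F U y, ((inner ℝ p q : ℝ) : EReal)) p hp)

theorem IsTimeInterval.left_mem (h : IsTimeInterval t₀ I) : t₀ ∈ I := by
  rcases h with rfl | ⟨T, hT, rfl⟩
  exacts [self_mem_Ici, left_mem_Ico.2 hT]

theorem IsTimeInterval.Icc_subset (h : IsTimeInterval t₀ I) {a b : ℝ} (ha : a ∈ I) (hb : b ∈ I) :
    Icc a b ⊆ I := by
  rcases h with rfl | ⟨T, hT, rfl⟩
  exacts [ordConnected_Ici.out ha hb, ordConnected_Ico.out ha hb]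

theorem IsTimeInterval.le (h : IsTimeInterval t₀ I) {t : ℝ} (ht : t ∈ I) : t₀ ≤ t := by
  rcases h with rfl | ⟨T, hT, rfl⟩
  exacts [ht, ht.1]

theorem IsSolution.ae_mem_Ioo (h : IsSolution F t₀ I x) {a b : ℝ} (ha : a ∈ I) (hb : b ∈ I) :
    ∀ᵐ t, t ∈ Ioo a b → ∃ v ∈ F (x t), HasDerivAt x v t := by
  have := ae_imp_of_ae_restrict h.deriv_mem
  filter_upwards [this] with t ht hmem
  exact ht (h.interval.Icc_subset ha hb (Ioo_subset_Icc_self hmem))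

theorem IsSolution.absCont_comp (h : IsSolution F t₀ I x) {f : EuclideanSpace ℝ (Fin n) → ℝ}
    (hf : LocallyLipschitzOn D f) {a b : ℝ} (ha : a ∈ I) (hb : b ∈ I)
    (hmem : ∀ t ∈ uIcc a b, x t ∈ D) : AbsolutelyContinuousOnInterval (fun t => f (x t)) a b := by
  have hac := h.absCont a ha b hb
  obtain ⟨K, hK⟩ := (hf.mono (image_subset_iff.2 hmem)).exists_lipschitzOnWith_of_compact
    (isCompact_uIcc.image_of_continuousOn hac.continuousOn)
  exact hac.lipschitzOn_comp hK

/-- Decrease of `V` along solutions. -/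
theorem IsSolution.sub_le (h : IsSolution F t₀ I x) (hD : IsOpen D)
    (hU : ∀ i, LocallyLipschitzOn D (U i) ∧ IsRegularOn (U i) D) (hV : LocallyLipschitzOn D V)
    {a b c : ℝ} (ha : a ∈ I) (hb : b ∈ I) (hab : a ≤ b) (hmem : ∀ t ∈ Icc a b, x t ∈ D)
    (hgen : ∀ t ∈ Icc a b, genDeriv F D U V (x t) ≤ (c : EReal)) :
    V (x b) - V (x a) ≤ c * (b - a) := by
  have hmem' : ∀ t ∈ uIcc a b, x t ∈ D := by rwa [uIcc_of_le hab]
  have hVac := h.absCont_comp hV ha hb hmem'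
  -- Countability of the family is what allows a single null set for all `i`.
  have hUae : ∀ᵐ t, ∀ i, t ∈ uIcc a b → DifferentiableAt ℝ (fun t => U i (x t)) t :=
    ae_all_iff.2 fun i => (h.absCont_comp (hU i).1 ha hb hmem').ae_differentiableAt
  refine hVac.sub_le_of_ae_deriv_le hab ?_
  filter_upwards [hUae, hVac.ae_differentiableAt, h.ae_mem_Ioo ha hb] with t htU htV htx ht
  have htI : t ∈ Icc a b := Ioo_subset_Icc_self ht
  have htu : t ∈ uIcc a b := by rwa [uIcc_of_le hab]
  have hline : ∀ {f : EuclideanSpace ℝ (Fin n) → ℝ} {v d}, LocallyLipschitzOn D f →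
      HasDerivAt x v t → HasDerivAt (fun s => f (x s)) d t → HasLineDerivAt ℝ f d (x t) v := by
    intro f v d hf hx hd
    obtain ⟨K, r, hr, hK⟩ := exists_lipschitzOnWith_ball hD hf (hmem t htI)
    exact hasLineDerivAt_of_hasDerivAt_comp hr hK hx hd
  obtain ⟨v, hv, hxv⟩ := htx ht
  exact EReal.coe_le_coe_iff.1 ((le_genDeriv hD hU hV (hmem t htI) hv
    (hline hV hxv (htV htu).hasDerivAt)
    fun i => ⟨_, hline (hU i).1 hxv (htU i htu).hasDerivAt⟩).trans (hgen t htI))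

/-! ### Invariant balls -/

/-- Solutions starting near the origin stay near the origin, as long as they exist. -/
theorem IsGenLyapunov.exists_invariant_ball (hV : IsGenLyapunov F D U V) (hD : IsOpen D)
    (h0 : (0 : EuclideanSpace ℝ (Fin n)) ∈ D)
    (hU : ∀ i, LocallyLipschitzOn D (U i) ∧ IsRegularOn (U i) D) {ε : ℝ} (hε : 0 < ε)
    (hεD : Metric.closedBall 0 ε ⊆ D) (t₀ : ℝ) :
    ∃ δ > 0, ∀ (I : Set ℝ) (x : ℝ → EuclideanSpace ℝ (Fin n)), IsSolution F t₀ I x →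
      ∀ a ∈ I, ‖x a‖ ≤ δ → ∀ t ∈ I, a ≤ t → ‖x t‖ ≤ ε := by
  have hVc : ContinuousOn V D := hV.locallyLipschitz.continuousOn
  have hsph : Metric.sphere (0 : EuclideanSpace ℝ (Fin n)) ε ⊆ D :=
    Metric.sphere_subset_closedBall.trans hεD
  -- A positive lower bound `m` for `V` on the sphere; this form also covers the empty sphere when
  -- `n = 0`.
  obtain ⟨m, hm, hmV⟩ := (isCompact_sphere (0 : EuclideanSpace ℝ (Fin n)) ε).exists_forall_le'
    (hVc.mono hsph) (a := 0) fun z hz => hV.posDef.2 z (hsph hz) <| by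
      rintro rfl
      simp at hz
      exact hε.ne hz
  have hlt : ∀ᶠ z in 𝓝 (0 : EuclideanSpace ℝ (Fin n)), V z < m :=
    (hVc.continuousAt (hD.mem_nhds h0)).eventually_lt_const (by rwa [hV.posDef.1])
  obtain ⟨δ, hδ, hδm⟩ := Metric.eventually_nhds_iff.1 hlt
  -- `δ / 2` turns the closed condition on `x a` into a strict one, giving `V (x a) < m`; `ε / 2`
  -- puts the start strictly inside the sphere.
  refine ⟨min (δ / 2) (ε / 2), by positivity, fun I x hx a ha hxa t ht hat => ?_⟩
  by_contra! hgt
  have hcont : ContinuousOn (fun s => ‖x s‖) (Icc a t) := by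
    rw [← uIcc_of_le hat]
    exact (hx.absCont a ha t ht).continuousOn.norm
  have hScomp : IsCompact (Icc a t ∩ (fun s => ‖x s‖) ⁻¹' Ici ε) :=
    isCompact_Icc.of_isClosed_subset
      (hcont.preimage_isClosed_of_isClosed isClosed_Icc isClosed_Ici) inter_subset_left
  -- `s` is the first time the norm reaches `ε`, so the curve is in the closed ball, hence in `D`,
  -- up to `s`.
  obtain ⟨s, ⟨hsI, hs⟩, hsmin⟩ := hScomp.exists_isLeast ⟨t, right_mem_Icc.2 hat, hgt.le⟩
  have has : a < s := by
    refine lt_of_le_of_ne hsI.1 ?_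
    rintro rfl
    have h1 : ε ≤ ‖x a‖ := hs
    linarith [min_le_right (δ / 2) (ε / 2)]
  have hbefore : ∀ u ∈ Ico a s, ‖x u‖ < ε := by
    intro u hu
    by_contra! hcon
    exact absurd (hsmin ⟨⟨hu.1, hu.2.le.trans hsI.2⟩, hcon⟩) (not_le.2 hu.2)
  have hseq : ‖x s‖ = ε := by
    refine le_antisymm ?_ hs
    have hcl : s ∈ closure (Ico a s) := by
      rw [closure_Ico has.ne]; exact right_mem_Icc.2 has.le
    refine ContinuousWithinAt.closure_le hcl
      ((hcont s hsI).mono (Ico_subset_Icc_self.trans (Icc_subset_Icc_right hsI.2)))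
      continuousWithinAt_const fun u hu => (hbefore u hu).le
  have hD' : ∀ u ∈ Icc a s, x u ∈ D := by
    intro u hu
    refine hεD (mem_closedBall_zero_iff.2 ?_)
    rcases hu.2.eq_or_lt with rfl | hus
    exacts [hseq.le, (hbefore u ⟨hu.1, hus⟩).le]
  have hsI' : s ∈ I := hx.interval.Icc_subset ha ht hsI
  have hdec := hx.sub_le hD hU hV.locallyLipschitz (c := 0) ha hsI' has.le hD'
    fun u hu => hV.genDeriv_nonpos _ (hD' u hu)
  have h1 : V (x a) < m := hδm (by
    rw [dist_zero_right]
    linarith [min_le_left (δ / 2) (ε / 2)])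
  have h2 := hmV (x s) (by simpa using hseq)
  linarith

/-! ### Completeness of confined maximal solutions -/

theorem LocallyBounded.exists_bound (hF : LocallyBounded F) {K : Set (EuclideanSpace ℝ (Fin n))}
    (hK : IsCompact K) : ∃ M : NNReal, ∀ y ∈ K, ∀ v ∈ F y, ‖v‖ ≤ M := by
  refine hK.induction_on (p := fun s => ∃ M : NNReal, ∀ y ∈ s, ∀ v ∈ F y, ‖v‖ ≤ M) ⟨0, by simp⟩
    (fun s t hst ⟨M, hM⟩ => ⟨M, fun y hy => hM y (hst hy)⟩) ?_ ?_
  · rintro s t ⟨M, hM⟩ ⟨M', hM'⟩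
    refine ⟨max M M', ?_⟩
    rintro y (hy | hy) v hv
    · exact (hM y hy v hv).trans (by simp)
    · exact (hM' y hy v hv).trans (by simp)
  · intro y _
    obtain ⟨N, hN, hb⟩ := hF y
    obtain ⟨M, hM⟩ := hb.exists_norm_le
    refine ⟨N, mem_nhdsWithin_of_mem_nhds hN, M.toNNReal, fun z hz v hv => ?_⟩
    exact (hM v (mem_biUnion hz hv)).trans (Real.le_coe_toNNReal M)

/-- A maximal solution that remains in a compact subset of `D` is complete. -/
theorem IsMaximalSolution.eq_Ici (h : IsMaximalSolution F t₀ I x) (hF : LocallyBounded F)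
    (hsol : AdmitsLocalSolutions F t₀ D) {K : Set (EuclideanSpace ℝ (Fin n))} (hK : IsCompact K)
    (hKD : K ⊆ D) (hmem : ∀ t ∈ I, x t ∈ K) : I = Ici t₀ := by
  have hs := h.isSolution
  rcases hs.interval with hI | ⟨T, hT, rfl⟩
  · exact hI
  exfalso
  obtain ⟨M, hM⟩ := hF.exists_bound hK
  have hdist : ∀ a ∈ Ico t₀ T, ∀ b ∈ Ico t₀ T, a ≤ b → dist (x a) (x b) ≤ M * dist a b := by
    intro a ha b hb hab
    rw [dist_comm, dist_comm a, dist_eq_norm, Real.dist_eq, abs_of_nonneg (sub_nonneg.2 hab)]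
    refine (hs.absCont a ha b hb).norm_sub_le_of_ae_hasDerivAt hab M.2 ?_
    filter_upwards [hs.ae_mem_Ioo ha hb] with t ht htab
    obtain ⟨v, hv, hxv⟩ := ht htab
    exact ⟨v, hM _ (hmem t (hs.interval.Icc_subset ha hb (Ioo_subset_Icc_self htab))) v hv, hxv⟩
  have hlip : LipschitzOnWith M x (Ico t₀ T) := by
    refine LipschitzOnWith.of_dist_le_mul fun a ha b hb => ?_
    rcases le_total a b with hab | hab
    · exact hdist a ha b hb hab
    · rw [dist_comm, dist_comm a]
      exact hdist b hb a ha hab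
  -- The bounded speed makes `x` Lipschitz, and a Lipschitz extension supplies its limit at `T`,
  -- from which a local solution can be appended.
  obtain ⟨g, hg, hgx⟩ := hlip.extend_finite_dimension
  have hTcl : T ∈ closure (Ico t₀ T) := by
    rw [closure_Ico hT.ne]; exact right_mem_Icc.2 hT.le
  have hgT : g T ∈ K := by
    have := image_closure_subset_closure_image hg.continuous (mem_image_of_mem g hTcl)
    rw [← hK.isClosed.closure_eq]
    refine closure_mono ?_ this
    rintro _ ⟨t, ht, rfl⟩
    rw [← hgx ht]
    exact hmem t ht
  obtain ⟨T', hT', y, hy, hyT⟩ := hsol (g T) (hKD hgT) T hT.le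
  set z : ℝ → EuclideanSpace ℝ (Fin n) := fun t => if t < T then g t else y t with hz
  have hzsol : IsSolution F t₀ (Ico t₀ T') z := by
    refine ⟨Or.inr ⟨T', hT.trans hT', rfl⟩, fun a ha b hb => ?_, ?_⟩
    -- The gluing interval must reach the junction `T` even when `a` and `b` lie before it.
    · have hcT : T ≤ max (max a b) T := le_max_right _ _
      have hc : max (max a b) T ∈ Ico T T' := ⟨hcT, max_lt (max_lt ha.2 hb.2) hT'⟩
      refine ((hg.lipschitzOnWith.absolutelyContinuousOnInterval).glue hT.le hcT
        (hy.absCont T (left_mem_Ico.2 hT') _ hc) hyT.symm).mono ?_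
      rw [uIcc_of_le (hT.le.trans hcT)]
      exact uIcc_subset_Icc ⟨ha.1, (le_max_left a b).trans (le_max_left _ _)⟩
        ⟨hb.1, (le_max_right a b).trans (le_max_left _ _)⟩
    · have h1 := ae_imp_of_ae_restrict hs.deriv_mem
      have h2 := ae_imp_of_ae_restrict hy.deriv_mem
      -- The endpoints are discarded because the derivative is two-sided: elsewhere `z` agrees with
      -- `x` or `y` on a full neighbourhood.
      have h3 : ∀ᵐ t : ℝ, t ≠ t₀ := by simp [ae_iff]
      have h4 : ∀ᵐ t : ℝ, t ≠ T := by simp [ae_iff]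
      refine (ae_restrict_iff' measurableSet_Ico).2 ?_
      filter_upwards [h1, h2, h3, h4] with t h1 h2 h3 h4 ht
      rcases h4.lt_or_gt with htT | htT
      · have hmemt : t ∈ Ioo t₀ T := ⟨lt_of_le_of_ne ht.1 h3.symm, htT⟩
        have heq : z =ᶠ[𝓝 t] x := by
          filter_upwards [isOpen_Ioo.mem_nhds hmemt] with s hs'
          rw [hz, hgx (Ioo_subset_Ico_self hs')]
          exact if_pos hs'.2
        obtain ⟨v, hv, hxv⟩ := h1 (Ioo_subset_Ico_self hmemt)
        exact ⟨v, by rwa [heq.eq_of_nhds], hxv.congr_of_eventuallyEq heq⟩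
      · have heq : z =ᶠ[𝓝 t] y := by
          filter_upwards [isOpen_Ioi.mem_nhds htT] with s hs'
          exact if_neg (not_lt.2 (le_of_lt hs'))
        obtain ⟨v, hv, hxv⟩ := h2 ⟨htT.le, ht.2⟩
        exact ⟨v, by rwa [heq.eq_of_nhds], hxv.congr_of_eventuallyEq heq⟩
  have hJ := h.maximal _ z hzsol (Ico_subset_Ico_right hT'.le) fun t ht => by
    rw [hz, hgx ht]
    exact if_pos ht.2
  have : T ∈ Ico t₀ T := hJ ▸ (⟨hT.le, hT'⟩ : T ∈ Ico t₀ T')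
  exact lt_irrefl _ this.2

/-! ### Convergence and stability -/

/-- A complete solution in a compact subset of `D` along which `V` decreases strictly converges
to the origin. -/
theorem IsGenLyapunov.tendsto_zero (hV : IsGenLyapunov F D U V) (hD : IsOpen D)
    (h0 : (0 : EuclideanSpace ℝ (Fin n)) ∈ D)
    (hU : ∀ i, LocallyLipschitzOn D (U i) ∧ IsRegularOn (U i) D)
    {W : EuclideanSpace ℝ (Fin n) → ℝ} (hWc : Continuous W) (hWpos : IsPosDefOn W univ)
    (hW : ∀ x ∈ D, genDeriv F D U V x ≤ ((-W x : ℝ) : EReal))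
    (hx : IsSolution F t₀ (Ici t₀) x) {K : Set (EuclideanSpace ℝ (Fin n))} (hK : IsCompact K)
    (hKD : K ⊆ D) (hmem : ∀ t, t₀ ≤ t → x t ∈ K) : Tendsto (fun t => ‖x t‖) atTop (𝓝 0) := by
  obtain ⟨ρ, hρ, hρD⟩ := Metric.nhds_basis_closedBall.mem_iff.1 (hD.mem_nhds h0)
  refine (nhds_basis_zero_abs_lt ℝ).tendsto_right_iff.2 fun ε hε => ?_
  have hε' : 0 < min ρ (ε / 2) := by positivity
  obtain ⟨δ, hδ, hinv⟩ := hV.exists_invariant_ball hD h0 hU hε'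
    ((Metric.closedBall_subset_closedBall (min_le_left _ _)).trans hρD) t₀
  -- The invariant ball may be entered at any time `a`, so a single visit to the `δ`-ball suffices.
  suffices ∃ a, t₀ ≤ a ∧ ‖x a‖ ≤ δ by
    obtain ⟨a, ha, hxa⟩ := this
    filter_upwards [eventually_ge_atTop a] with t ht
    have := hinv _ x hx a ha hxa t (ha.trans ht) ht
    have h2 := min_le_right ρ (ε / 2)
    rw [abs_norm]
    linarith
  by_contra! hfar
  obtain ⟨w, hw, hwW⟩ := (hK.inter_right
    (isClosed_le continuous_const continuous_norm : IsClosed {z | δ ≤ ‖z‖})).exists_forall_le'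
    hWc.continuousOn (a := 0) fun z hz => hWpos.2 z (mem_univ z) <| by
      rintro rfl
      have : δ ≤ ‖(0 : EuclideanSpace ℝ (Fin n))‖ := hz.2
      rw [norm_zero] at this
      linarith
  have hVnonneg : ∀ y ∈ D, 0 ≤ V y := by
    intro y hy
    rcases eq_or_ne y 0 with rfl | hne
    exacts [hV.posDef.1.ge, (hV.posDef.2 y hy hne).le]
  have hVt₀ := hVnonneg _ (hKD (hmem t₀ le_rfl))
  -- Decay at rate at least `w` lowers `V` by `V (x t₀) + 1` before `τ`, leaving `V (x τ) ≤ -1`.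
  set τ := t₀ + (V (x t₀) + 1) / w with hτ
  have hτ₀ : t₀ ≤ τ := by
    have : 0 ≤ (V (x t₀) + 1) / w := by positivity
    linarith
  have hdec := hx.sub_le hD hU hV.locallyLipschitz (c := -w) self_mem_Ici hτ₀ hτ₀
    (fun t ht => hKD (hmem t ht.1)) fun t ht => (hW _ (hKD (hmem t ht.1))).trans
      (EReal.coe_le_coe_iff.2 (neg_le_neg (hwW _ ⟨hmem t ht.1, (hfar t ht.1).le⟩)))
  have hval : -w * (τ - t₀) = -(V (x t₀) + 1) := by
    rw [hτ]; field_simp; ring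
  linarith [hVnonneg _ (hKD (hmem τ hτ₀))]

/-- Maximal solutions starting near the origin are complete and stay near the origin. -/
theorem IsGenLyapunov.exists_complete (hV : IsGenLyapunov F D U V) (hD : IsOpen D)
    (h0 : (0 : EuclideanSpace ℝ (Fin n)) ∈ D)
    (hU : ∀ i, LocallyLipschitzOn D (U i) ∧ IsRegularOn (U i) D) (hF : LocallyBounded F)
    (hsol : AdmitsLocalSolutions F t₀ D) {ε : ℝ} (hε : 0 < ε) (hεD : Metric.closedBall 0 ε ⊆ D) :
    ∃ δ > 0, ∀ (I : Set ℝ) (x : ℝ → EuclideanSpace ℝ (Fin n)),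
      IsMaximalSolution F t₀ I x → x t₀ ∈ Metric.closedBall 0 δ →
        I = Ici t₀ ∧ ∀ t, t₀ ≤ t → x t ∈ Metric.closedBall 0 ε := by
  obtain ⟨δ, hδ, hinv⟩ := hV.exists_invariant_ball hD h0 hU hε hεD t₀
  refine ⟨δ, hδ, fun I x hx hx₀ => ?_⟩
  have hint := hx.isSolution.interval
  have hmem : ∀ t ∈ I, x t ∈ Metric.closedBall 0 ε := fun t ht => mem_closedBall_zero_iff.2 <|
    hinv I x hx.isSolution t₀ hint.left_mem (mem_closedBall_zero_iff.1 hx₀) t ht (hint.le ht)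
  have hI := hx.eq_Ici hF hsol (isCompact_closedBall 0 ε) hεD hmem
  exact ⟨hI, fun t ht => hmem t (hI ▸ ht)⟩

theorem IsGenLyapunov.isStable (hV : IsGenLyapunov F D U V) (hD : IsOpen D)
    (h0 : (0 : EuclideanSpace ℝ (Fin n)) ∈ D)
    (hU : ∀ i, LocallyLipschitzOn D (U i) ∧ IsRegularOn (U i) D) (hF : LocallyBounded F)
    (hsol : AdmitsLocalSolutions F t₀ D) : IsStable F t₀ := by
  intro ε hε
  obtain ⟨ρ, hρ, hρD⟩ := Metric.nhds_basis_closedBall.mem_iff.1 (hD.mem_nhds h0)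
  obtain ⟨δ, hδ, h⟩ := hV.exists_complete hD h0 hU hF hsol (lt_min hρ hε)
    ((Metric.closedBall_subset_closedBall (min_le_left _ _)).trans hρD)
  exact ⟨δ, hδ, fun I x hx hx₀ => ⟨(h I x hx hx₀).1, fun t ht =>
    Metric.closedBall_subset_closedBall (min_le_right _ _) ((h I x hx hx₀).2 t ht)⟩⟩

end DiffIncl

theorem mainTheorem3 (n : ℕ) (t₀ : ℝ)
    (D : Set (EuclideanSpace ℝ (Fin n))) (hDopen : IsOpen D) (hDconn : IsConnected D)
    (h0 : (0 : EuclideanSpace ℝ (Fin n)) ∈ D)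
    (F : EuclideanSpace ℝ (Fin n) → Set (EuclideanSpace ℝ (Fin n)))
    (hFbdd : DiffIncl.LocallyBounded F) (hFcomp : ∀ x, IsCompact (F x))
    (hFsol : DiffIncl.AdmitsLocalSolutions F t₀ D)
    (U : ℕ → EuclideanSpace ℝ (Fin n) → ℝ)
    (hU : ∀ i, LocallyLipschitzOn D (U i) ∧ DiffIncl.IsRegularOn (U i) D)
    (V : EuclideanSpace ℝ (Fin n) → ℝ) (hV : DiffIncl.IsGenLyapunov F D U V) :
    DiffIncl.IsStable F t₀ ∧
    ((∃ W : EuclideanSpace ℝ (Fin n) → ℝ, Continuous W ∧ DiffIncl.IsPosDefOn W Set.univ ∧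
        ∀ x ∈ D, DiffIncl.genDeriv F D U V x ≤ ((-W x : ℝ) : EReal)) →
      DiffIncl.IsAsymptoticallyStable F t₀ ∧
      (D = Set.univ → (∀ l : ℝ, 0 < l → IsCompact {x | V x ≤ l}) →
        DiffIncl.IsGloballyAsymptoticallyStable F t₀)) := by
  have hstable := hV.isStable hDopen h0 hU hFbdd hFsol
  refine ⟨hstable, ?_⟩
  rintro ⟨W, hWc, hWpos, hW⟩
  refine ⟨⟨hstable, ?_⟩, fun hDuniv hsub => ⟨hstable, fun I x hx => ?_⟩⟩
  · obtain ⟨ρ, hρ, hρD⟩ := Metric.nhds_basis_closedBall.mem_iff.1 (hDopen.mem_nhds h0)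
    obtain ⟨δ, hδ, h⟩ := hV.exists_complete hDopen h0 hU hFbdd hFsol hρ hρD
    refine ⟨δ, hδ, fun I x hx hx₀ => ?_⟩
    obtain ⟨rfl, hmem⟩ := h I x hx hx₀
    exact ⟨rfl, hV.tendsto_zero hDopen h0 hU hWc hWpos hW hx.isSolution
      (isCompact_closedBall 0 ρ) hρD hmem⟩
  · have hsol := hx.isSolution
    have hD : ∀ y, y ∈ D := fun y => hDuniv ▸ mem_univ y
    -- The maximum with `1` keeps the level positive when `x t₀ = 0`, as compactness is given only
    -- for `l > 0`.
    have hK : IsCompact {y | V y ≤ max (V (x t₀)) 1} := hsub _ (by positivity)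
    have hmem : ∀ t ∈ I, x t ∈ {y | V y ≤ max (V (x t₀)) 1} := fun t ht => by
      have := hsol.sub_le hDopen hU hV.locallyLipschitz (c := 0) hsol.interval.left_mem ht
        (hsol.interval.le ht) (fun s _ => hD _) fun s _ => hV.genDeriv_nonpos _ (hD _)
      exact le_max_of_le_left (by linarith : V (x t) ≤ V (x t₀))
    obtain rfl := hx.eq_Ici hFbdd hFsol hK (fun y _ => hD y) hmem
    exact ⟨rfl, hV.tendsto_zero hDopen h0 hU hWc hWpos hW hsol hK (fun y _ => hD y) hmem⟩
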